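/- Write $p\doteq q$ for equality up to a factor $\pm t^i$, $i\in\mathbb Z$, and call $p(t)$ reciprocal if $p(t^{-1})\doteq p(t)$. Let $f(t)=t^2-t-1$ and let $$C=\begin{pmatrix}0&0&-1\\1&0&0\\0&1&2\end{pmatrix}$$ be the companion matrix of $(t-1)f(t)$; thus $\det C=-1$, so $C\in \mathrm{GL}_3\mathbb Z$ and $-C\in \mathrm{SL}_3\mathbb Z$. For a knot with group $\pi$, given by a Wirtinger presentation $\langle x_0,\dots,x_k\mid r_1,\dots,r_k\rangle$ read off a diagram, let $\epsilon(x_i)=t$. For $\gamma:\pi\to \mathrm{GL}_n\mathbb C$ let $\Phi:\mathbb Z[\pi]\to M_n(\mathbb C[t^{\pm1}])$, $\Phi(g)=\epsilon(g)\gamma(g)$, and let $M^0_{\gamma\otimes\epsilon}$ be the $kn\times kn$ matrix with blocks $\Phi(\partial r_i/\partial x_j)$, $1\le i,j\le k$ (Fox derivatives). The Alexander polynomial $\Delta(t)$ is $\det M^0$ for the trivial one-dimensional representation; the Wada invariant is $W_\gamma(t)=\det M^0_{\gamma\otimes\epsilon}/\det\Phi(x_0-1)$; and $\tau_\gamma(t)$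 is the Reidemeister torsion of the twisted chain complex $C_*(X;\mathbb C(t)\otimes\mathbb C^n)$ of the exterior $X$ (computed from the 2-complex of the presentation), defined up to sign when that complex is acyclic. There is a knot with $\Delta(t)\doteq f(t)f(t^{-1})$. For every such knot: (a) There is a unique representation $\gamma:\pi\to \mathrm{GL}_3\mathbb Z$ sending each generator $x_0,\dots,x_k$ to $C$. It is not conjugate over $\mathbb C$ to its dual $g\mapsto {}^t\gamma(g)^{-1}$, its torsion is defined and is represented by $W_\gamma(t)$, $$\tau_\gamma(t)\doteq (t^2-t-1)(t-1)(t+1)^2(t^2-3t+1)(t^2+3t+1),$$ and $\tau_\gamma(t)$ is non-reciprocal. (b) There is a unique representation $\gamma':\pi\to \mathrm{SL}_3\mathbb Z$ sending each generator to $-C$. It is not conjugate over $\mathbb C$ to its dual, its torsion is defined and is represented by $W_{\gamma'}(t)$, $$\tau_{\gamma'}(t)\doteq (t^2+t-1)(t+1)(t-1)^2(t^2-3t+1)(t^2+3t+1),$$ and $\tau_{\gamma'}(t)$ is non-reciprocal. In particular, reciprocality fails for $\mathrm{SL}_3\mathbb Z$ representations of knot groups that are not conjugate to their duals. -/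

import Mathlib

open Matrix LaurentPolynomial

noncomputable section

/-! ### Fox calculus -/

/-- The Fox derivative of a word in the letters `(a, true) = a` and `(a, false) = a⁻¹`. -/
def foxWord {α : Type} [DecidableEq α] (j : α) :
    List (α × Bool) → MonoidAlgebra ℤ (FreeGroup α)
  | [] => 0
  | (a, true) :: w =>
      (if a = j then 1 else 0) + MonoidAlgebra.of ℤ _ (FreeGroup.of a) * foxWord j w
  | (a, false) :: w =>
      (if a = j then -MonoidAlgebra.of ℤ _ (FreeGroup.of a)⁻¹ else 0)
        + MonoidAlgebra.of ℤ _ (FreeGroup.of a)⁻¹ * foxWord j w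

theorem foxWord_append {α : Type} [DecidableEq α] (j : α) (u v : List (α × Bool)) :
    foxWord j (u ++ v)
      = foxWord j u + MonoidAlgebra.of ℤ _ (FreeGroup.mk u) * foxWord j v := by
  induction u with
  | nil => simp [foxWord, ← FreeGroup.one_eq_mk, ← MonoidAlgebra.one_def]
  | cons a u ih =>
    obtain ⟨a, b⟩ := a
    have h : ∀ b, (FreeGroup.mk ((a, b) :: u) : FreeGroup α)
        = FreeGroup.mk [(a, b)] * FreeGroup.mk u := by
      intro b; rw [FreeGroup.mul_mk]; rfl
    cases b
    · have h2 : (FreeGroup.mk [(a, false)] : FreeGroup α) = (FreeGroup.of a)⁻¹ := by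
        rw [FreeGroup.of, FreeGroup.inv_mk]; rfl
      simp only [List.cons_append, foxWord, ih, h, map_mul, h2, mul_add, mul_assoc, add_assoc]
    · have h2 : (FreeGroup.mk [(a, true)] : FreeGroup α) = FreeGroup.of a := rfl
      simp only [List.cons_append, foxWord, ih, h, map_mul, h2, mul_add, mul_assoc, add_assoc]

theorem foxWord_step {α : Type} [DecidableEq α] (j : α) (u v : List (α × Bool))
    (h : FreeGroup.Red.Step u v) : foxWord j u = foxWord j v := by
  obtain ⟨⟩ := h
  rename_i l r a b
  have h1 : MonoidAlgebra.of ℤ (FreeGroup α) (FreeGroup.of a)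
      * MonoidAlgebra.of ℤ _ (FreeGroup.of a)⁻¹ = 1 := by rw [← map_mul, mul_inv_cancel, map_one]
  have h2 : MonoidAlgebra.of ℤ (FreeGroup α) (FreeGroup.of a)⁻¹
      * MonoidAlgebra.of ℤ _ (FreeGroup.of a) = 1 := by rw [← map_mul, inv_mul_cancel, map_one]
  rw [foxWord_append, foxWord_append]
  congr 2
  cases b
  · simp only [Bool.not_false, foxWord, mul_add, ← mul_assoc, h2]
    split_ifs <;> simp
  · simp only [Bool.not_true, foxWord, mul_add, ← mul_assoc, h1]
    split_ifs <;> simp [-MonoidAlgebra.of_apply, h1]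

/-- The Fox derivative `∂/∂x_j : F → ℤ[F]` on the free group `F` on the letters `α`. -/
def foxDeriv {α : Type} [DecidableEq α] (j : α) (g : FreeGroup α) :
    MonoidAlgebra ℤ (FreeGroup α) :=
  Quot.lift (foxWord j) (foxWord_step j) g

theorem foxDeriv_one {α : Type} [DecidableEq α] (j : α) :
    foxDeriv j (1 : FreeGroup α) = 0 := rfl

theorem foxDeriv_of {α : Type} [DecidableEq α] (j a : α) :
    foxDeriv j (FreeGroup.of a) = if a = j then 1 else 0 := by
  change foxWord j [(a, true)] = _
  simp [foxWord]

theorem foxDeriv_mul {α : Type} [DecidableEq α] (j : α) (g h : FreeGroup α) :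
    foxDeriv j (g * h) = foxDeriv j g + MonoidAlgebra.of ℤ _ g * foxDeriv j h := by
  induction g using Quot.inductionOn with | _ u
  induction h using Quot.inductionOn with | _ v
  exact foxWord_append j u v

/-! ### Knot diagrams -/

/-- A signed Gauss diagram with `k + 1` crossings. One travels once along an oriented closed curve,
which passes the crossings `2k + 2` times: each crossing `c` once on the upper strand, at time
`upper c`, and once on the lower strand, at time `lower c`. The passage at time `p` leads from the
edge `p` to the edge `p + 1` (cyclically). `positive c` says that `c` is a positive (right-handed)
crossing: the lower strand crosses the upper one from right to left.

`arc e` is the arc (from one undercrossing to the next one) that contains the edge `e`, where the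
arc numbered `c` is the one that starts at the undercrossing of `c`; this function is determined by
its two laws. -/
structure GaussDiagram (k : ℕ) where
  upper : Fin (k + 1) → Fin (2 * k + 2)
  lower : Fin (k + 1) → Fin (2 * k + 2)
  bijective : Function.Bijective (Sum.elim upper lower)
  positive : Fin (k + 1) → Bool
  arc : Fin (2 * k + 2) → Fin (k + 1)
  arc_lower : ∀ c, arc (lower c + 1) = c
  arc_upper : ∀ c, arc (upper c + 1) = arc (upper c)

/-- An edge with a direction: `(e, true)` is the edge `e` travelled along the orientation of the
curve, `(e, false)` is the same edge travelled backwards. -/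
abbrev GaussDiagram.Dart (k : ℕ) : Type := Fin (2 * k + 2) × Bool

/-- `D.TurnLeft d d'`: whoever arrives at a crossing along `d` and turns left there leaves it
along `d'`. -/
inductive GaussDiagram.TurnLeft {k : ℕ} (D : GaussDiagram k) :
    GaussDiagram.Dart k → GaussDiagram.Dart k → Prop
  | pos_upper (c) (h : D.positive c = true) :
      D.TurnLeft (D.upper c, true) (D.lower c + 1, true)
  | pos_lower (c) (h : D.positive c = true) :
      D.TurnLeft (D.lower c, true) (D.upper c, false)
  | pos_upper_back (c) (h : D.positive c = true) :
      D.TurnLeft (D.upper c + 1, false) (D.lower c, false)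
  | pos_lower_back (c) (h : D.positive c = true) :
      D.TurnLeft (D.lower c + 1, false) (D.upper c + 1, true)
  | neg_upper (c) (h : D.positive c = false) :
      D.TurnLeft (D.upper c, true) (D.lower c, false)
  | neg_lower (c) (h : D.positive c = false) :
      D.TurnLeft (D.lower c, true) (D.upper c + 1, true)
  | neg_upper_back (c) (h : D.positive c = false) :
      D.TurnLeft (D.upper c + 1, false) (D.lower c + 1, true)
  | neg_lower_back (c) (h : D.positive c = false) :
      D.TurnLeft (D.lower c + 1, false) (D.upper c, false)

/-- The faces of the closed oriented surface that carries the diagram: the classes of darts under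
repeated left turns. -/
def GaussDiagram.Face {k : ℕ} (D : GaussDiagram k) : Type := Quot D.TurnLeft

/-- A diagram of an oriented classical knot with `k + 1` crossings, that is, a signed Gauss diagram
that can be drawn on the sphere: the Euler characteristic
`(k + 1) - (2k + 2) + (number of faces)` is `2`. Every knot has such a diagram
(with at least one crossing). -/
structure KnotDiagram (k : ℕ) extends GaussDiagram k where
  planar : Nat.card toGaussDiagram.Face = k + 3

namespace KnotDiagram

variable {k : ℕ} (D : KnotDiagram k)

/-- The Wirtinger relator `r_c` at the crossing `c`: with `o` the upper arc, `i` the incoming and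
`c` the outgoing lower arc, it says `x_o x_c = x_i x_o` at a positive crossing and
`x_o x_i = x_c x_o` at a negative one. -/
def relator (c : Fin (k + 1)) : FreeGroup (Fin (k + 1)) :=
  let o := FreeGroup.of (D.arc (D.upper c))
  let i := FreeGroup.of (D.arc (D.lower c))
  let j := FreeGroup.of c
  if D.positive c = true then o * j * o⁻¹ * i⁻¹ else o * i * o⁻¹ * j⁻¹

/-- The knot group `π`, with the Wirtinger generators of the `k + 1` arcs and the relators of the
`k + 1` crossings (any one of which is a consequence of the others). -/
abbrev knotGroup : Type := PresentedGroup (Set.range D.relator)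

/-- The class in the knot group of the Wirtinger generator of an arc. -/
def gen (a : Fin (k + 1)) : D.knotGroup := PresentedGroup.of a

/-- The abelianization `ε : π → ⟨t⟩ ≅ ℤ`, which maps every Wirtinger generator to `t`. -/
def abelianize : D.knotGroup →* Multiplicative ℤ :=
  PresentedGroup.toGroup (f := fun _ => Multiplicative.ofAdd (1 : ℤ)) <| by
    rintro _ ⟨c, rfl⟩
    simp only [relator]
    split_ifs <;> simp

variable {R : Type} [CommRing R] {n : ℕ}

/-- `g ↦ t ^ ε(g) γ(g)` -/
def twist (γ : D.knotGroup →* GL (Fin n) R) : D.knotGroup →* Matrix (Fin n) (Fin n) R[T;T⁻¹] where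
  toFun g := (T (D.abelianize g).toAdd : R[T;T⁻¹]) • (γ g).1.map (C : R →+* R[T;T⁻¹])
  map_one' := by simp
  map_mul' g h := by
    simp only [map_mul, toAdd_mul, T_add, Units.val_mul, Matrix.map_mul, Matrix.smul_mul,
      Matrix.mul_smul, smul_smul, mul_comm (T (D.abelianize g).toAdd : R[T;T⁻¹])]

/-- The ring homomorphism `Φ = γ ⊗ ε : ℤ[π] → M_n(R[t, t⁻¹])`. -/
def Phi (γ : D.knotGroup →* GL (Fin n) R) :
    MonoidAlgebra ℤ D.knotGroup →ₐ[ℤ] Matrix (Fin n) (Fin n) R[T;T⁻¹] :=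
  MonoidAlgebra.lift ℤ (Matrix (Fin n) (Fin n) R[T;T⁻¹]) D.knotGroup (D.twist γ)

/-- The matrix `M_{γ ⊗ ε}` with the blocks `Φ(∂r_i/∂x_j)`, for the Wirtinger presentation of the
knot group by all `k + 1` generators and the `k` relators other than `r_{c₀}`. -/
def foxMatrix (c₀ : Fin (k + 1)) (γ : D.knotGroup →* GL (Fin n) R) :
    Matrix (Fin k × Fin n) (Fin (k + 1) × Fin n) R[T;T⁻¹] :=
  Matrix.of fun p q =>
    D.Phi γ (MonoidAlgebra.mapDomainRingHom ℤ (PresentedGroup.mk (Set.range D.relator))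
      (foxDeriv q.1 (D.relator (c₀.succAbove p.1)))) p.2 q.2

/-- The square matrix `M⁰_{γ ⊗ ε}`: the block column of the generator `x_{a₀}` is deleted. -/
def foxMatrix₀ (c₀ a₀ : Fin (k + 1)) (γ : D.knotGroup →* GL (Fin n) R) :
    Matrix (Fin k × Fin n) (Fin k × Fin n) R[T;T⁻¹] :=
  (D.foxMatrix c₀ γ).submatrix id (fun q => (a₀.succAbove q.1, q.2))

/-- The block column with the blocks `Φ(x_j - 1)`. -/
def augMatrix (γ : D.knotGroup →* GL (Fin n) R) :
    Matrix (Fin (k + 1) × Fin n) (Fin n) R[T;T⁻¹] :=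
  Matrix.of fun p q => D.Phi γ (MonoidAlgebra.of ℤ _ (D.gen p.1) - 1) p.2 q

/-- The Alexander polynomial, from the given Wirtinger presentation: `det M⁰` for the trivial
representation of rank one. -/
def alexanderPolynomial (c₀ a₀ : Fin (k + 1)) : ℤ[T;T⁻¹] :=
  (D.foxMatrix₀ c₀ a₀ (1 : D.knotGroup →* GL (Fin 1) ℤ)).det

end KnotDiagram

/-! ### Rational functions, torsion and the Wada invariant -/

/-- The inclusion `ℂ[t, t⁻¹] → ℂ(t)`. -/
def laurentToRatFunc : ℂ[T;T⁻¹] →+* RatFunc ℂ :=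
  LaurentPolynomial.eval₂ (RatFunc.C : ℂ →+* RatFunc ℂ) (Units.mk0 RatFunc.X RatFunc.X_ne_zero)

/-- `p ≐ q` in `ℤ[t, t⁻¹]`: equality up to a factor `± t ^ i`. -/
def LaurentDotEq (p q : ℤ[T;T⁻¹]) : Prop :=
  ∃ (s : ℤˣ) (i : ℤ), p = C (s : ℤ) * T i * q

/-- `p ≐ q` in `ℂ(t)`: equality up to a factor `± t ^ i`. -/
def DotEq (p q : RatFunc ℂ) : Prop :=
  ∃ (s : ℤˣ) (i : ℤ), p = ((s : ℤ) : RatFunc ℂ) * RatFunc.X ^ i * q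

/-- `p(t⁻¹) ≐ p(t)` -/
def Reciprocal (p : RatFunc ℂ) : Prop :=
  DotEq (RatFunc.eval RatFunc.C (RatFunc.X⁻¹) p) p

/-- `τ` is the Reidemeister torsion of the based complex `0 → F^I → F^J → F^K → 0` of row vectors
whose boundary maps are right multiplication by `d₂` and `d₁`. The torsion is defined only if the
complex is acyclic. It is
`[∂b₂, b₁ / c₁] · [b₂ / c₂]⁻¹ · [∂b₁ / c₀]⁻¹`,
where the `c_i` are the standard bases, `b₂` is any basis of `F^I`, and `b₁` is any family in `F^J`
whose boundary is a basis of `F^K` (both given by the rows of a matrix), and `[b / c]` is the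
determinant of the change of basis. The bijection `e` orders the family `(∂b₂, b₁)`,
so that `τ` is defined up to sign. -/
structure IsReidemeisterTorsion {F : Type} [Field F] {I J K : Type} [Fintype I] [Fintype J]
    [Fintype K] [DecidableEq I] [DecidableEq J] [DecidableEq K]
    (d₂ : Matrix I J F) (d₁ : Matrix J K F) (τ : F) : Prop where
  isComplex : d₂ * d₁ = 0
  injective : Function.Injective fun v : I → F => v ᵥ* d₂
  exact : ∀ w : J → F, w ᵥ* d₁ = 0 → ∃ v : I → F, v ᵥ* d₂ = w
  surjective : Function.Surjective fun w : J → F => w ᵥ* d₁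
  exists_bases : ∃ (b₂ : Matrix I I F) (b₁ : Matrix K J F) (e : J ≃ I ⊕ K),
    b₂.det ≠ 0 ∧ (b₁ * d₁).det ≠ 0 ∧
      τ = ((Matrix.fromRows (b₂ * d₂) b₁).submatrix e id).det / (b₂.det * (b₁ * d₁).det)

namespace KnotDiagram

variable {k : ℕ} (D : KnotDiagram k) {n : ℕ}

/-- The Wada invariant `W_γ(t) = det M⁰ / det Φ(x_{a₀} - 1)`. -/
def wada (c₀ a₀ : Fin (k + 1)) (γ : D.knotGroup →* GL (Fin n) ℂ) : RatFunc ℂ :=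
  laurentToRatFunc (D.foxMatrix₀ c₀ a₀ γ).det /
    laurentToRatFunc (D.Phi γ (MonoidAlgebra.of ℤ _ (D.gen a₀) - 1)).det

/-- `τ` is the twisted Reidemeister torsion `τ_γ(t)` of the knot: the torsion of the complex
`C_*(X; V(t))` over `ℂ(t)`, with `V = ℂⁿ` and `X` the 2-complex of the Wirtinger presentation
(one vertex, `k + 1` edges, `k` two-cells), to which the exterior of the knot collapses. -/
def IsTwistedTorsion (c₀ : Fin (k + 1)) (γ : D.knotGroup →* GL (Fin n) ℂ) (τ : RatFunc ℂ) : Prop :=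
  IsReidemeisterTorsion ((D.foxMatrix c₀ γ).map laurentToRatFunc)
    ((D.augMatrix γ).map laurentToRatFunc) τ

end KnotDiagram

/-- The representation `γ` is conjugate to its dual `g ↦ ᵗγ(g)⁻¹`. -/
def ConjugateToDual {G : Type} [Group G] {n : ℕ} (γ : G →* GL (Fin n) ℂ) : Prop :=
  ∃ A : GL (Fin n) ℂ, ∀ g, (A⁻¹ * γ g * A).1 = ((γ g)⁻¹).1ᵀ

/-- The integral representation `γ`, regarded as a complex one. -/
def complexify {G : Type} [Group G] {n : ℕ} (γ : G →* GL (Fin n) ℤ) : G →* GL (Fin n) ℂ :=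
  (Matrix.GeneralLinearGroup.map (Int.castRingHom ℂ)).comp γ

/-- The companion matrix of `(t - 1)(t² - t - 1) = t³ - 2t² + 1`. Its determinant is `-1`. -/
def companionMatrix : Matrix (Fin 3) (Fin 3) ℤ :=
  !![0, 0, -1; 1, 0, 0; 0, 1, 2]

end

/-!
Let `γ` send every Wirtinger generator to the same matrix `u`. Then `γ` factors through the
abelianization, so that `Φ = γ ⊗ ε` is the abelianization `ℤ[π] → ℤ[t, t⁻¹]` followed by the
substitution `t ↦ t u`. This gives existence and uniqueness of `γ`, and it shows that the blocks
of `M⁰` are the values at `t u` of the entries of the Alexander matrix. They commute, so the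
determinant of `M⁰` is the determinant of the matrix `Δ(t u)` (`KnotDiagram.det_foxMatrix₀`). For
`u = ± C`, `x = ± t` and `Δ ≐ f(t) f(t⁻¹)`, the determinants of `f(x C)` and `f((x C)⁻¹)` are
three-by-three computations, and the denominator `det (x C - 1) = -(x - 1)(x² + x - 1)` cancels
(`wada_dotEq`). Both signs of `u` are treated at once, with a sign `s : ℤˣ`.

The torsion is computed over any field for a complex `F^I → F^J → F^K` whose boundary maps have
nonvanishing complementary minors: the complex is acyclic, and its torsion is, up to sign, the
quotient of the two minors (`isReidemeisterTorsion_of_minors`,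
`IsReidemeisterTorsion.eq_of_minors`). For the twisted complex of a knot, `d₂ * d₁ = 0` is the
fundamental formula of Fox calculus, and the quotient of the minors is the Wada invariant.

The representation is not conjugate to its dual because `C` and `C⁻¹` have the traces `2` and `0`.
The torsion is not reciprocal because, in the variable `x`, it vanishes at the golden ratio `φ` but
not at `φ⁻¹`.

A knot with `Δ ≐ f(t) f(t⁻¹) ≐ t⁴ - 3 t² + 1` is the closure of a braid on five strands with 12
crossings. Planarity of its diagram is checked by listing the faces. Its Alexander matrix
`M⁰` has linear polynomials as entries; after a permutation of the rows, an explicit upper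
triangular matrix `V` makes `M⁰ V` lower triangular, which is checked coefficient by coefficient
over `ℤ`, and `Δ` is read off from the diagonals (`exampleKnot_alexanderPolynomial`).
-/

noncomputable section

/-! ### Fox calculus and the Alexander matrix -/

theorem foxDeriv_inv {α : Type} [DecidableEq α] (j : α) (g : FreeGroup α) :
    foxDeriv j g⁻¹ = -(MonoidAlgebra.of ℤ _ g⁻¹ * foxDeriv j g) := by
  rw [eq_neg_iff_add_eq_zero, ← foxDeriv_mul, inv_mul_cancel, foxDeriv_one]

/-- The fundamental formula of Fox calculus. -/
theorem sum_foxDeriv_mul {α : Type} [DecidableEq α] [Fintype α] (g : FreeGroup α) :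
    ∑ j, foxDeriv j g * (MonoidAlgebra.of ℤ _ (FreeGroup.of j) - 1)
      = MonoidAlgebra.of ℤ _ g - 1 := by
  induction g using FreeGroup.induction_on with
  | C1 => simp [foxDeriv_one, -MonoidAlgebra.of_apply]
  | of a => simp [foxDeriv_of, ite_mul, -MonoidAlgebra.of_apply]
  | inv_of a ih =>
    simp only [foxDeriv_inv, neg_mul, Finset.sum_neg_distrib, mul_assoc, ← Finset.mul_sum]
    rw [ih, mul_sub, ← map_mul, inv_mul_cancel, map_one, mul_one, neg_sub]
  | mul g h hg hh =>
    simp only [foxDeriv_mul, add_mul, Finset.sum_add_distrib, mul_assoc, ← Finset.mul_sum, hg, hh]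
    rw [mul_sub, map_mul, mul_one]
    abel

namespace KnotDiagram

variable {k : ℕ} (D : KnotDiagram k)

theorem abelianize_gen (a : Fin (k + 1)) :
    D.abelianize (D.gen a) = Multiplicative.ofAdd (1 : ℤ) := by
  simp [abelianize, gen]

theorem hom_ext {G : Type} [Group G] {γ γ' : D.knotGroup →* G}
    (h : ∀ a, γ (D.gen a) = γ' (D.gen a)) : γ = γ' :=
  PresentedGroup.ext h

/-- A representation of the knot group that is constant on the Wirtinger generators factors
through the abelianization. -/
theorem eq_zpow_abelianize {G : Type} [Group G] {γ : D.knotGroup →* G} {u : G}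
    (h : ∀ a, γ (D.gen a) = u) : γ = (zpowersHom G u).comp D.abelianize :=
  D.hom_ext fun a => by simp [h, abelianize_gen]

theorem existsUnique_hom_const {G : Type} [Group G] (u : G) :
    ∃! γ : D.knotGroup →* G, ∀ a, γ (D.gen a) = u := by
  refine ⟨(zpowersHom G u).comp D.abelianize, fun a => by simp [abelianize_gen], fun γ h => ?_⟩
  exact D.eq_zpow_abelianize h

/-- The ring homomorphism `ℤ[π] → ℤ[t, t⁻¹]` induced by the abelianization. -/
def abelRingHom : MonoidAlgebra ℤ D.knotGroup →ₐ[ℤ] ℤ[T;T⁻¹] :=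
  MonoidAlgebra.lift ℤ ℤ[T;T⁻¹] D.knotGroup
    { toFun := fun g => T (D.abelianize g).toAdd
      map_one' := by simp
      map_mul' := fun g h => by rw [map_mul, toAdd_mul, T_add] }

theorem abelRingHom_of (g : D.knotGroup) :
    D.abelRingHom (MonoidAlgebra.of ℤ _ g) = T (D.abelianize g).toAdd :=
  MonoidAlgebra.lift_of _ _

/-- The Alexander matrix over `ℤ[t, t⁻¹]`, with the abelianized Fox derivatives `∂r_c/∂x_j` of all
the Wirtinger relators. -/
def alexanderMatrix : Matrix (Fin (k + 1)) (Fin (k + 1)) ℤ[T;T⁻¹] :=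
  Matrix.of fun c j => D.abelRingHom
    (MonoidAlgebra.mapDomainRingHom ℤ (PresentedGroup.mk (Set.range D.relator))
      (foxDeriv j (D.relator c)))

/-- The Alexander matrix with the row of `c₀` and the column of `a₀` deleted. -/
def alexanderMatrix₀ (c₀ a₀ : Fin (k + 1)) : Matrix (Fin k) (Fin k) ℤ[T;T⁻¹] :=
  D.alexanderMatrix.submatrix c₀.succAbove a₀.succAbove

theorem Phi_of {R : Type} [CommRing R] {n : ℕ} (γ : D.knotGroup →* GL (Fin n) R)
    (g : D.knotGroup) : D.Phi γ (MonoidAlgebra.of ℤ _ g)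
      = (T (D.abelianize g).toAdd : R[T;T⁻¹]) • (γ g).1.map (C : R →+* R[T;T⁻¹]) :=
  MonoidAlgebra.lift_of _ _

end KnotDiagram

/-- The ring homomorphism `ℤ[t, t⁻¹] → M_n(R[t, t⁻¹])` that maps `t` to `t u`. -/
def laurentAeval {R : Type} [CommRing R] {n : ℕ} (u : GL (Fin n) R) :
    ℤ[T;T⁻¹] →ₐ[ℤ] Matrix (Fin n) (Fin n) R[T;T⁻¹] :=
  AddMonoidAlgebra.lift ℤ _ ℤ
    { toFun := fun i => (T i.toAdd : R[T;T⁻¹]) • (u ^ i.toAdd).1.map (C : R →+* R[T;T⁻¹])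
      map_one' := by simp
      map_mul' := fun i j => by
        simp only [toAdd_mul, T_add, _root_.zpow_add, Units.val_mul, Matrix.map_mul, Matrix.smul_mul,
          Matrix.mul_smul, smul_smul, mul_comm (T i.toAdd : R[T;T⁻¹])] }

theorem laurentAeval_T {R : Type} [CommRing R] {n : ℕ} (u : GL (Fin n) R) (i : ℤ) :
    laurentAeval u (T i) = (T i : R[T;T⁻¹]) • (u ^ i).1.map (C : R →+* R[T;T⁻¹]) := by
  rw [laurentAeval, T, AddMonoidAlgebra.lift_single, one_smul]
  rfl

namespace KnotDiagram

variable {k : ℕ} (D : KnotDiagram k) {R : Type} [CommRing R] {n : ℕ}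

theorem Phi_eq_laurentAeval {γ : D.knotGroup →* GL (Fin n) R} {u : GL (Fin n) R}
    (h : ∀ a, γ (D.gen a) = u) (x : MonoidAlgebra ℤ D.knotGroup) :
    D.Phi γ x = laurentAeval u (D.abelRingHom x) := by
  have : D.Phi γ = (laurentAeval u).comp D.abelRingHom := by
    apply MonoidAlgebra.algHom_ext
    · intro g
      rw [AlgHom.comp_apply]
      change D.Phi γ (MonoidAlgebra.of ℤ _ g) = laurentAeval u (D.abelRingHom
        (MonoidAlgebra.of ℤ _ g))
      rw [Phi_of, abelRingHom_of, laurentAeval_T, D.eq_zpow_abelianize h]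
      rfl
    · ext
  rw [this]
  rfl

/-- For a representation that is constant on the generators, `M⁰` arises from the Alexander matrix
by the substitution `t ↦ t u`; its blocks commute, so that its determinant is the determinant of
the value of the Alexander polynomial at `t u`. -/
theorem det_foxMatrix₀ {γ : D.knotGroup →* GL (Fin n) R} {u : GL (Fin n) R}
    (h : ∀ a, γ (D.gen a) = u) (c₀ a₀ : Fin (k + 1)) :
    (D.foxMatrix₀ c₀ a₀ γ).det = (laurentAeval u (D.alexanderMatrix₀ c₀ a₀).det).det := by
  refine Eq.trans ?_ (Matrix.det_det (D.alexanderMatrix₀ c₀ a₀) (laurentAeval u).toRingHom).symm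
  congr 1
  ext ⟨i, a⟩ ⟨j, b⟩
  simp only [foxMatrix₀, foxMatrix, submatrix_apply, of_apply, id, D.Phi_eq_laurentAeval h,
    comp_apply, map_apply, alexanderMatrix₀, alexanderMatrix]
  rfl

theorem alexanderPolynomial_eq_det (c₀ a₀ : Fin (k + 1)) :
    D.alexanderPolynomial c₀ a₀ = (D.alexanderMatrix₀ c₀ a₀).det := by
  rw [alexanderPolynomial, D.det_foxMatrix₀ (u := 1) fun _ => rfl]
  generalize (D.alexanderMatrix₀ c₀ a₀).det = p
  have : Matrix.scalarAlgHom (Fin 1) ℤ = laurentAeval (1 : GL (Fin 1) ℤ) := by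
    apply AddMonoidAlgebra.algHom_ext
    · intro i
      refine Eq.trans ?_ (laurentAeval_T 1 i).symm
      change Matrix.scalar (Fin 1) (T i : ℤ[T;T⁻¹]) = _
      ext a b : 2
      simp [Subsingleton.elim a b]
    · ext
  rw [← this]
  simp

/-- The boundary maps of the chain complex compose to zero. -/
theorem foxMatrix_mul_augMatrix (c₀ : Fin (k + 1)) (γ : D.knotGroup →* GL (Fin n) R) :
    D.foxMatrix c₀ γ * D.augMatrix γ = 0 := by
  ext ⟨i, a⟩ b
  have h := congrArg (MonoidAlgebra.mapDomainRingHom ℤ (PresentedGroup.mk (Set.range D.relator)))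
    (sum_foxDeriv_mul (D.relator (c₀.succAbove i)))
  have hr : PresentedGroup.mk (Set.range D.relator) (D.relator (c₀.succAbove i)) = 1 :=
    PresentedGroup.one_of_mem ⟨_, rfl⟩
  have hof : ∀ g, MonoidAlgebra.mapDomainRingHom ℤ (PresentedGroup.mk (Set.range D.relator))
      (MonoidAlgebra.of ℤ _ g)
        = MonoidAlgebra.of ℤ _ (PresentedGroup.mk (Set.range D.relator) g) := fun g => by simp
  simp only [map_sum, map_mul, map_sub, hof, hr, map_one, sub_self] at h
  have h' := congrFun₂ (congrArg (D.Phi γ) h) a b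
  rw [map_sum, map_zero, Matrix.sum_apply] at h'
  simp only [map_mul, Matrix.mul_apply, Matrix.zero_apply] at h'
  rw [Matrix.mul_apply, Fintype.sum_prod_type, Matrix.zero_apply, ← h']
  rfl

end KnotDiagram

/-! ### The torsion of a complex of length two -/

section Torsion

variable {F : Type} [Field F] {I J K : Type} [Fintype I] [Fintype J] [Fintype K]
  [DecidableEq I] [DecidableEq K]

/-- The identity behind the computation of the torsion from minors: multiply the matrix of the
family `(∂b₂, b₁)` by the matrix that has `d₁` as its last columns and unit vectors as the others,
which makes it block triangular because `d₂ * d₁ = 0`. -/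
theorem det_fromRows_mul_det {d₂ : Matrix I J F} {d₁ : Matrix J K F} (e₀ : I ⊕ K ≃ J)
    (hd : d₂ * d₁ = 0) (b₂ : Matrix I I F) (b₁ : Matrix K J F) :
    ((Matrix.fromRows (b₂ * d₂) b₁).submatrix id e₀).det *
        (d₁.submatrix (e₀ ∘ Sum.inr) id).det
      = b₂.det * (d₂.submatrix id (e₀ ∘ Sum.inl)).det * (b₁ * d₁).det := by
  have key : (Matrix.fromRows (b₂ * d₂) b₁).submatrix id e₀ *
      Matrix.fromBlocks 1 (d₁.submatrix (e₀ ∘ Sum.inl) id) 0 (d₁.submatrix (e₀ ∘ Sum.inr) id)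
      = Matrix.fromBlocks (b₂ * d₂.submatrix id (e₀ ∘ Sum.inl)) 0
          (b₁.submatrix id (e₀ ∘ Sum.inl)) (b₁ * d₁) := by
    have h0 : ∀ i x, ∑ j, (b₂ * d₂) i j * d₁ j x = 0 := fun i x => by
      rw [← Matrix.mul_apply, Matrix.mul_assoc, hd, Matrix.mul_zero, Matrix.zero_apply]
    ext (i | i) (j | j)
    · simp [Matrix.mul_apply, Matrix.one_apply]
    · rw [Matrix.mul_apply, fromBlocks_apply₁₂, Matrix.zero_apply, ← h0 i j, ← e₀.sum_comp]
      simp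
    · simp [Matrix.mul_apply, Matrix.one_apply]
    · rw [Matrix.mul_apply, fromBlocks_apply₂₂, Matrix.mul_apply, ← e₀.sum_comp]
      simp
  have h := congrArg Matrix.det key
  rwa [det_mul, det_fromBlocks_zero₂₁, det_fromBlocks_zero₁₂, det_one, one_mul, det_mul] at h

variable [DecidableEq J]

/-- If the complementary minors of the two boundary maps do not vanish, then the complex is acyclic
and its torsion is represented by their quotient. -/
theorem isReidemeisterTorsion_of_minors {d₂ : Matrix I J F} {d₁ : Matrix J K F} (e₀ : I ⊕ K ≃ J)
    (hd : d₂ * d₁ = 0) (h₂ : (d₂.submatrix id (e₀ ∘ Sum.inl)).det ≠ 0)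
    (h₁ : (d₁.submatrix (e₀ ∘ Sum.inr) id).det ≠ 0) :
    IsReidemeisterTorsion d₂ d₁
      ((d₂.submatrix id (e₀ ∘ Sum.inl)).det / (d₁.submatrix (e₀ ∘ Sum.inr) id).det) where
  isComplex := hd
  injective := by
    have hinj := Matrix.vecMul_injective_of_isUnit
      ((Matrix.isUnit_iff_isUnit_det _).2 (isUnit_iff_ne_zero.2 h₂))
    intro v w hvw
    exact hinj (funext fun i => congrFun hvw (e₀ (Sum.inl i)))
  exact := by
    intro w hw
    have hinj := Matrix.vecMul_injective_of_isUnit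
      ((Matrix.isUnit_iff_isUnit_det _).2 (isUnit_iff_ne_zero.2 h₁))
    obtain ⟨v, hv⟩ := (Matrix.vecMul_surjective_iff_isUnit.2
      ((Matrix.isUnit_iff_isUnit_det _).2 (isUnit_iff_ne_zero.2 h₂))) fun i => w (e₀ (Sum.inl i))
    refine ⟨v, ?_⟩
    -- The difference is a cycle supported on the block `K`, where `d₁` is injective.
    set z := v ᵥ* d₂ - w with hz
    have hz1 : z ᵥ* d₁ = 0 := by
      rw [hz, Matrix.sub_vecMul, Matrix.vecMul_vecMul, hd, hw, Matrix.vecMul_zero, sub_zero]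
    have hzl : ∀ i, z (e₀ (Sum.inl i)) = 0 := fun i => by
      have := congrFun hv i
      rw [hz, Pi.sub_apply, sub_eq_zero]
      exact this
    have hzr : (fun i => z (e₀ (Sum.inr i))) = 0 := by
      apply hinj
      ext x
      have := congrFun hz1 x
      simp only [Matrix.vecMul, dotProduct, ← e₀.sum_comp, Fintype.sum_sum_type, hzl, zero_mul,
        Finset.sum_const_zero, zero_add] at this
      simpa [Matrix.vecMul, dotProduct] using this
    rw [← sub_eq_zero]
    ext j
    obtain ⟨i | i, rfl⟩ := e₀.surjective j
    · exact hzl i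
    · exact congrFun hzr i
  surjective := by
    intro y
    obtain ⟨v, hv⟩ := (Matrix.vecMul_surjective_iff_isUnit.2
      ((Matrix.isUnit_iff_isUnit_det _).2 (isUnit_iff_ne_zero.2 h₁))) y
    refine ⟨fun j => Sum.elim 0 v (e₀.symm j), ?_⟩
    rw [← hv]
    ext x
    simp [Matrix.vecMul, dotProduct, ← e₀.sum_comp]
  exists_bases := by
    have hb : ((1 : Matrix J J F).submatrix (e₀ ∘ Sum.inr) id) * d₁
        = d₁.submatrix (e₀ ∘ Sum.inr) id := by
      ext i j
      simp [Matrix.mul_apply, Matrix.one_apply]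
    refine ⟨1, (1 : Matrix J J F).submatrix (e₀ ∘ Sum.inr) id, e₀.symm, by simp, ?_, ?_⟩
    · rwa [hb]
    · have h := det_fromRows_mul_det e₀ hd 1 ((1 : Matrix J J F).submatrix (e₀ ∘ Sum.inr) id)
      rw [hb, det_one, one_mul] at h
      rw [hb, det_one, one_mul, ← mul_right_cancel₀ h₁ h,
        ← det_submatrix_equiv_self e₀, submatrix_submatrix]
      congr 3
      ext i
      simp

/-- The torsion is unique up to sign; the sign is that of the permutation that compares the two
orderings of the basis of `F^J`. -/
theorem IsReidemeisterTorsion.eq_of_minors {d₂ : Matrix I J F} {d₁ : Matrix J K F} {τ : F}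
    (h : IsReidemeisterTorsion d₂ d₁ τ) (e₀ : I ⊕ K ≃ J)
    (h₁ : (d₁.submatrix (e₀ ∘ Sum.inr) id).det ≠ 0) :
    ∃ s : ℤˣ, τ = ((s : ℤ) : F) *
      ((d₂.submatrix id (e₀ ∘ Sum.inl)).det / (d₁.submatrix (e₀ ∘ Sum.inr) id).det) := by
  obtain ⟨b₂, b₁, e, hb₂, hb₁, rfl⟩ := h.exists_bases
  refine ⟨Equiv.Perm.sign (e₀.trans e), ?_⟩
  have h := det_fromRows_mul_det e₀ h.isComplex b₂ b₁
  have hs : (Matrix.fromRows (b₂ * d₂) b₁).submatrix e id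
      = (((Matrix.fromRows (b₂ * d₂) b₁).submatrix id e₀).submatrix (e₀.trans e) id).submatrix
        e₀.symm e₀.symm := by
    ext i j
    simp
  rw [hs, det_submatrix_equiv_self, det_permute, mul_div_assoc]
  congr 1
  rw [div_eq_div_iff (mul_ne_zero hb₂ hb₁) h₁, h]
  ring

end Torsion

namespace KnotDiagram

variable {k : ℕ} (D : KnotDiagram k) {n : ℕ}

/-- The basis of `C₁` split into the part off the generator `x_{a₀}` and the part at `x_{a₀}`. -/
def splitBasis (n : ℕ) (a₀ : Fin (k + 1)) :
    (Fin k × Fin n) ⊕ Fin n ≃ Fin (k + 1) × Fin n :=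
  Equiv.ofBijective (Sum.elim (fun q => (a₀.succAbove q.1, q.2)) fun i => (a₀, i)) <| by
    constructor
    · rintro (⟨q, i⟩ | i) (⟨q', i'⟩ | i') h
      · simpa [Fin.succAbove_right_injective.eq_iff] using h
      · simp [Fin.succAbove_ne] at h
      · simp [Fin.ne_succAbove] at h
      · simpa using h
    · rintro ⟨j, i⟩
      rcases Fin.eq_self_or_eq_succAbove a₀ j with rfl | ⟨q, rfl⟩
      · exact ⟨Sum.inr i, rfl⟩
      · exact ⟨Sum.inl (q, i), rfl⟩

theorem wada_eq_minors (c₀ a₀ : Fin (k + 1)) (γ : D.knotGroup →* GL (Fin n) ℂ) :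
    D.wada c₀ a₀ γ =
      (((D.foxMatrix c₀ γ).map laurentToRatFunc).submatrix id (splitBasis n a₀ ∘ Sum.inl)).det /
      (((D.augMatrix γ).map laurentToRatFunc).submatrix (splitBasis n a₀ ∘ Sum.inr) id).det := by
  rw [wada, RingHom.map_det, RingHom.map_det]
  rfl

/-- Wherever the Wada invariant is defined and does not vanish, the twisted chain complex is
acyclic and the Wada invariant is its torsion. -/
theorem isTwistedTorsion_wada {c₀ a₀ : Fin (k + 1)} {γ : D.knotGroup →* GL (Fin n) ℂ}
    (h : D.wada c₀ a₀ γ ≠ 0) : D.IsTwistedTorsion c₀ γ (D.wada c₀ a₀ γ) := by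
  rw [wada_eq_minors] at h ⊢
  refine isReidemeisterTorsion_of_minors _ ?_ (div_ne_zero_iff.1 h).1 (div_ne_zero_iff.1 h).2
  rw [← Matrix.map_mul, foxMatrix_mul_augMatrix, Matrix.map_zero _ (map_zero _)]

theorem IsTwistedTorsion.eq_wada {c₀ a₀ : Fin (k + 1)} {γ : D.knotGroup →* GL (Fin n) ℂ}
    {τ : RatFunc ℂ} (hτ : D.IsTwistedTorsion c₀ γ τ) (h : D.wada c₀ a₀ γ ≠ 0) :
    ∃ s : ℤˣ, τ = ((s : ℤ) : RatFunc ℂ) * D.wada c₀ a₀ γ := by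
  rw [wada_eq_minors] at h ⊢
  exact IsReidemeisterTorsion.eq_of_minors hτ _ (div_ne_zero_iff.1 h).2

end KnotDiagram

/-! ### Determinants of values at the companion matrix -/

section CommRing

variable {A : Type} [CommRing A] (x : A)

theorem det_companion_sub_one :
    (!![0, 0, -x; x, 0, 0; 0, x, 2 * x] - 1 : Matrix (Fin 3) (Fin 3) A).det
      = -((x - 1) * (x ^ 2 + x - 1)) := by
  simp only [det_fin_three, Matrix.sub_apply]
  simp
  ring

/-- The determinant of `f(x C)`. As `C` has the eigenvalues `1`, `φ` and `-φ⁻¹`, it is the product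
of `f` at `x`, `φ x` and `-φ⁻¹ x`. -/
theorem det_fib_companion :
    (!![0, 0, -x; x, 0, 0; 0, x, 2 * x] * !![0, 0, -x; x, 0, 0; 0, x, 2 * x]
        - !![0, 0, -x; x, 0, 0; 0, x, 2 * x] - 1 : Matrix (Fin 3) (Fin 3) A).det
      = (x ^ 2 - x - 1) * (x - 1) ^ 2 * (x ^ 2 + 3 * x + 1) := by
  simp only [det_fin_three, Matrix.sub_apply]
  simp [Matrix.mul_apply, Fin.sum_univ_three]
  ring

/-- The determinant of `f(x C⁻¹)`. -/
theorem det_fib_companion_inv :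
    (!![0, x, 0; 2 * x, 0, x; -x, 0, 0] * !![0, x, 0; 2 * x, 0, x; -x, 0, 0]
        - !![0, x, 0; 2 * x, 0, x; -x, 0, 0] - 1 : Matrix (Fin 3) (Fin 3) A).det
      = (x ^ 2 - x - 1) * (x + 1) ^ 2 * (x ^ 2 - 3 * x + 1) := by
  simp only [det_fin_three, Matrix.sub_apply]
  simp [Matrix.mul_apply, Fin.sum_univ_three]
  ring

end CommRing

/-- The matrix `± C`, as an element of `GL₃(ℤ)`. -/
def signedCompanion (s : ℤˣ) : GL (Fin 3) ℤ where
  val := (s : ℤ) • companionMatrix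
  inv := (s : ℤ) • !![0, 1, 0; 2, 0, 1; -1, 0, 0]
  val_inv := by rcases Int.units_eq_one_or s with rfl | rfl <;> decide +kernel
  inv_val := by rcases Int.units_eq_one_or s with rfl | rfl <;> decide +kernel

/-- The matrix `± C`, as an element of `GL₃(ℂ)`. -/
def complexCompanion (s : ℤˣ) : GL (Fin 3) ℂ :=
  Matrix.GeneralLinearGroup.map (Int.castRingHom ℂ) (signedCompanion s)

theorem complexCompanion_val (s : ℤˣ) :
    (complexCompanion s).1 = ((s : ℤ) • companionMatrix).map (Int.castRingHom ℂ) := rfl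

theorem complexCompanion_inv_val (s : ℤˣ) : (complexCompanion s)⁻¹.1
    = ((s : ℤ) • !![0, 1, 0; 2, 0, 1; -1, 0, 0]).map (Int.castRingHom ℂ) := by
  rw [complexCompanion, ← map_inv]
  rfl

theorem trace_complexCompanion (s : ℤˣ) : (complexCompanion s).1.trace = 2 * (s : ℤ) := by
  rw [complexCompanion_val]
  simp [trace_fin_three, companionMatrix, mul_comm]

theorem trace_complexCompanion_inv (s : ℤˣ) : (complexCompanion s)⁻¹.1.trace = 0 := by
  rw [complexCompanion_inv_val]
  simp [trace_fin_three]

theorem laurentAeval_companion_T_one (s : ℤˣ) :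
    laurentAeval (complexCompanion s) (T 1) =
      !![0, 0, -(((s : ℤ) : ℂ[T;T⁻¹]) * T 1); ((s : ℤ) : ℂ[T;T⁻¹]) * T 1, 0, 0;
        0, ((s : ℤ) : ℂ[T;T⁻¹]) * T 1, 2 * (((s : ℤ) : ℂ[T;T⁻¹]) * T 1)] := by
  rw [laurentAeval_T, zpow_one, complexCompanion_val]
  ext i j : 1
  have h2 : (C 2 : ℂ[T;T⁻¹]) = 2 := map_ofNat C 2
  fin_cases i <;> fin_cases j <;> (simp [companionMatrix, h2]; try ring)

theorem laurentAeval_companion_T_neg_one (s : ℤˣ) :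
    laurentAeval (complexCompanion s) (T (-1)) =
      !![0, ((s : ℤ) : ℂ[T;T⁻¹]) * T (-1), 0;
        2 * (((s : ℤ) : ℂ[T;T⁻¹]) * T (-1)), 0, ((s : ℤ) : ℂ[T;T⁻¹]) * T (-1);
        -(((s : ℤ) : ℂ[T;T⁻¹]) * T (-1)), 0, 0] := by
  rw [laurentAeval_T, _root_.zpow_neg_one, complexCompanion_inv_val]
  ext i j : 1
  have h2 : (C 2 : ℂ[T;T⁻¹]) = 2 := map_ofNat C 2
  fin_cases i <;> fin_cases j <;> (simp [h2]; try ring)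

/-! ### The Wada invariant for `± C` -/

theorem laurentToRatFunc_T (i : ℤ) : laurentToRatFunc (T i) = RatFunc.X ^ i := by
  rw [laurentToRatFunc, eval₂_T]; simp

/-- A unit of `ℤ[t, t⁻¹]` only contributes a factor `± t ^ i` to the Wada invariant, because
`det (± C) = ± 1`. -/
theorem det_laurentAeval_unit (s e : ℤˣ) (i : ℤ) :
    ∃ e' : ℤˣ, (laurentAeval (complexCompanion s) (C (e : ℤ) * T i)).det
      = ((e' : ℤ) : ℂ[T;T⁻¹]) * T (3 * i) := by
  have hC : (C (e : ℤ) : ℤ[T;T⁻¹]) = ((e : ℤ) : ℤ[T;T⁻¹]) := by simp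
  refine ⟨e * Matrix.GeneralLinearGroup.det (signedCompanion s) ^ i, ?_⟩
  have h1 : ((laurentAeval (complexCompanion s)) (C (e : ℤ))).det = ((e : ℤ) : ℂ[T;T⁻¹]) := by
    rw [hC, map_intCast]
    rcases Int.units_eq_one_or e with rfl | rfl
    · simp
    · simp [det_neg, show (-1 : ℂ[T;T⁻¹]) ^ 3 = -1 by ring]
  have h2 : (((complexCompanion s ^ i).1).map (C : ℂ →+* ℂ[T;T⁻¹])).det
      = (((Matrix.GeneralLinearGroup.det (signedCompanion s) ^ i : ℤˣ) : ℤ) : ℂ[T;T⁻¹]) := by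
    rw [complexCompanion, ← map_zpow, ← map_zpow]
    have : ∀ g : GL (Fin 3) ℤ, (((Matrix.GeneralLinearGroup.map (Int.castRingHom ℂ) g).1).map
        (C : ℂ →+* ℂ[T;T⁻¹])).det = ((g.1.det : ℤ) : ℂ[T;T⁻¹]) := by
      intro g
      rw [← RingHom.mapMatrix_apply, ← RingHom.map_det]
      have : (Matrix.GeneralLinearGroup.map (Int.castRingHom ℂ) g).1
        = (Int.castRingHom ℂ).mapMatrix g.1 := rfl
      rw [this, ← RingHom.map_det]
      simp
    exact this _
  rw [map_mul, det_mul, h1, laurentAeval_T, det_smul, h2, Fintype.card_fin, T_pow, Units.val_mul]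
  push_cast
  ring

/-- The polynomial `f(x)(x - 1)(x + 1)²(x² - 3x + 1)(x² + 3x + 1)`. -/
def torsionValue {A : Type} [CommRing A] (x : A) : A :=
  (x ^ 2 - x - 1) * (x - 1) * (x + 1) ^ 2 * (x ^ 2 - 3 * x + 1) * (x ^ 2 + 3 * x + 1)

/-- The reverse of the polynomial `torsionValue`. -/
def reverseTorsionValue {A : Type} [CommRing A] (x : A) : A :=
  (1 - x - x ^ 2) * (1 - x) * (1 + x) ^ 2 * (1 - 3 * x + x ^ 2) * (1 + 3 * x + x ^ 2)

theorem map_torsionValue {A B : Type} [CommRing A] [CommRing B] (f : A →+* B) (x : A) :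
    f (torsionValue x) = torsionValue (f x) := by
  simp [torsionValue, map_ofNat f]

theorem map_reverseTorsionValue {A B : Type} [CommRing A] [CommRing B] (f : A →+* B) (x : A) :
    f (reverseTorsionValue x) = reverseTorsionValue (f x) := by
  simp [reverseTorsionValue, map_ofNat f]

theorem pow_mul_torsionValue {F : Type} [Field F] {x : F} (hx : x ≠ 0) :
    x ^ 9 * torsionValue x⁻¹ = reverseTorsionValue x := by
  simp only [torsionValue, reverseTorsionValue]
  field_simp

/-- The torsion vanishes at the golden ratio, and `reverseTorsionValue_ne_zero` says that its
reverse does not. -/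
theorem torsionValue_eq_zero {F : Type} [Field F] {x : F} (hx : x ^ 2 = x + 1) :
    torsionValue x = 0 := by
  simp [torsionValue, hx]

theorem reverseTorsionValue_ne_zero {F : Type} [Field F] [CharZero F] {x : F}
    (hx : x ^ 2 = x + 1) : reverseTorsionValue x ≠ 0 := by
  have h0 : x ≠ 0 := by rintro rfl; simp at hx
  have h1 : 1 - x ≠ 0 := fun h => by
    obtain rfl : x = 1 := by linear_combination -h
    norm_num at hx
  have h2 : 1 + x ≠ 0 := fun h => by
    obtain rfl : x = -1 := by linear_combination h
    norm_num at hx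
  have h3 : 1 + 2 * x ≠ 0 := fun h => by
    exact one_ne_zero (α := F) (by linear_combination (2 * x - 3) * h - 4 * hx)
  have : reverseTorsionValue x
      = (-2 * x) * (1 - x) * (1 + x) ^ 2 * (2 * (1 - x)) * (2 * (1 + 2 * x)) := by
    simp only [reverseTorsionValue, hx]
    ring
  rw [this]
  have two : (2 : F) ≠ 0 := two_ne_zero
  simp only [ne_eq, mul_eq_zero, neg_eq_zero, pow_eq_zero_iff, OfNat.ofNat_ne_zero,
    not_false_eq_true, not_or]
  tauto

theorem torsionValue_X_ne_zero (s : ℤˣ) :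
    torsionValue (((s : ℤ) : RatFunc ℂ) * RatFunc.X) ≠ 0 := by
  have : torsionValue (((s : ℤ) : RatFunc ℂ) * RatFunc.X) = algebraMap (Polynomial ℂ) (RatFunc ℂ)
      (torsionValue (((s : ℤ) : Polynomial ℂ) * Polynomial.X)) := by
    simp [map_torsionValue, RatFunc.algebraMap_X]
  rw [this, ne_eq, map_eq_zero_iff _ (RatFunc.algebraMap_injective ℂ)]
  intro h
  have h := congrArg (Polynomial.evalRingHom 0) h
  simp [torsionValue] at h

/-- The substitution `t ↦ t⁻¹` is defined on all of `ℂ(t)`. -/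
theorem eval_X_inv_denom_ne_zero (r : RatFunc ℂ) :
    Polynomial.eval₂ (RatFunc.C : ℂ →+* RatFunc ℂ) RatFunc.X⁻¹ r.denom ≠ 0 := by
  intro h
  have : IsAlgebraic ℂ (RatFunc.X⁻¹ : RatFunc ℂ) := ⟨r.denom, r.denom_ne_zero, h⟩
  exact RatFunc.transcendental_X (by simpa using this.inv)

/-- If the torsion were reciprocal, then the polynomial `torsionValue` and its reverse would agree
up to a factor `± t ^ i`; but the golden ratio is a root of one of them only. -/
theorem not_reciprocal {s : ℤˣ} {τ : RatFunc ℂ}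
    (h : DotEq τ (torsionValue (((s : ℤ) : RatFunc ℂ) * RatFunc.X))) : ¬ Reciprocal τ := by
  rintro ⟨e', j, h'⟩
  obtain ⟨e, i, h⟩ := h
  obtain ⟨m, n, rfl⟩ : ∃ m n : ℕ, i = m - n := ⟨i.toNat, (-i).toNat, by omega⟩
  have hX : (RatFunc.X : RatFunc ℂ) ≠ 0 := RatFunc.X_ne_zero
  have hs : (((s : ℤ) : RatFunc ℂ)) * ((s : ℤ) : RatFunc ℂ) = 1 := by
    rcases Int.units_eq_one_or s with rfl | rfl <;> simp
  have he : ((e : ℤ) : RatFunc ℂ) ≠ 0 := by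
    rcases Int.units_eq_one_or e with rfl | rfl <;> simp
  have h1 : τ * algebraMap (Polynomial ℂ) (RatFunc ℂ) (Polynomial.X ^ n)
      = algebraMap (Polynomial ℂ) (RatFunc ℂ) (((e : ℤ) : Polynomial ℂ) * Polynomial.X ^ m *
        torsionValue (((s : ℤ) : Polynomial ℂ) * Polynomial.X)) := by
    simp only [map_mul, map_pow, map_intCast, map_torsionValue, RatFunc.algebraMap_X]
    rw [h, zpow_sub₀ hX, zpow_natCast, zpow_natCast]
    field_simp
  have h2 := congrArg (RatFunc.eval RatFunc.C (RatFunc.X⁻¹)) h1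
  rw [RatFunc.eval_mul _ _ (eval_X_inv_denom_ne_zero _) (eval_X_inv_denom_ne_zero _),
    RatFunc.eval_algebraMap, RatFunc.eval_algebraMap, h', h] at h2
  simp only [Algebra.algebraMap_self, RingHom.id_apply, ← Polynomial.coe_eval₂RingHom, map_mul,
    map_pow, map_intCast, map_torsionValue] at h2
  simp only [Polynomial.coe_eval₂RingHom, Polynomial.eval₂_X] at h2
  set x : RatFunc ℂ := ((s : ℤ) : RatFunc ℂ) * RatFunc.X with hx
  have hx0 : x ≠ 0 := mul_ne_zero (left_ne_zero_of_mul_eq_one hs) hX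
  have hxi : ((s : ℤ) : RatFunc ℂ) * RatFunc.X⁻¹ = x⁻¹ := by
    rw [hx, mul_inv, ← eq_inv_of_mul_eq_one_left hs]
  rw [hxi] at h2
  -- Clearing denominators gives an identity of polynomials in `t`.
  have h3 : ∃ (u : ℤˣ) (p q : ℕ), RatFunc.X ^ q * reverseTorsionValue x
      = ((u : ℤ) : RatFunc ℂ) * RatFunc.X ^ p * torsionValue x := by
    have h4 : torsionValue x⁻¹
        = ((e' : ℤ) : RatFunc ℂ) * RatFunc.X ^ (j + 2 * m - 2 * n) * torsionValue x := by
      have h5 : (RatFunc.X : RatFunc ℂ) ^ (j + 2 * m - 2 * n)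
          = RatFunc.X ^ j * RatFunc.X ^ ((m : ℤ) - n) * RatFunc.X⁻¹ ^ n * RatFunc.X ^ m := by
        rw [← zpow_natCast, ← zpow_natCast, _root_.inv_zpow', ← zpow_add₀ hX, ← zpow_add₀ hX,
          ← zpow_add₀ hX]
        congr 1
        ring
      have hm : (RatFunc.X : RatFunc ℂ) ^ m * RatFunc.X⁻¹ ^ m = 1 := by
        rw [← mul_pow, mul_inv_cancel₀ hX, one_pow]
      apply mul_left_cancel₀ he
      rw [h5]
      linear_combination -RatFunc.X ^ m * h2 - ((e : ℤ) : RatFunc ℂ) * torsionValue x⁻¹ * hm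
    obtain ⟨p, q, hpq⟩ : ∃ p q : ℕ, j + 2 * m - 2 * n + 9 = p - q :=
      ⟨(j + 2 * m - 2 * n + 9).toNat, (-(j + 2 * m - 2 * n + 9)).toNat, by omega⟩
    refine ⟨s * e', p, q, ?_⟩
    have h6 : (RatFunc.X : RatFunc ℂ) ^ p
        = RatFunc.X ^ q * (RatFunc.X ^ 9 * RatFunc.X ^ (j + 2 * m - 2 * n)) := by
      rw [← zpow_natCast, ← zpow_natCast, ← zpow_natCast, ← zpow_add₀ hX, ← zpow_add₀ hX]
      congr 1
      push_cast
      omega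
    have h7 : x ^ 9 = ((s : ℤ) : RatFunc ℂ) * RatFunc.X ^ 9 := by
      rw [hx, mul_pow]
      congr 1
      linear_combination ((s : ℤ) : RatFunc ℂ) * ((((s : ℤ) : RatFunc ℂ) ^ 2) ^ 3 +
        (((s : ℤ) : RatFunc ℂ) ^ 2) ^ 2 + ((s : ℤ) : RatFunc ℂ) ^ 2 + 1) * hs
    rw [← pow_mul_torsionValue hx0, h4, h6, h7]
    push_cast
    ring
  obtain ⟨u, p, q, h3⟩ := h3
  have h4 : (Polynomial.X ^ q * reverseTorsionValue (((s : ℤ) : Polynomial ℂ) * Polynomial.X))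
      = ((u : ℤ) : Polynomial ℂ) * Polynomial.X ^ p *
        torsionValue (((s : ℤ) : Polynomial ℂ) * Polynomial.X) := by
    apply RatFunc.algebraMap_injective ℂ
    simpa [map_torsionValue, map_reverseTorsionValue, RatFunc.algebraMap_X] using h3
  obtain ⟨y, hy⟩ : ∃ y : ℂ, y ^ 2 = y + 1 :=
    ⟨Real.goldenRatio, by exact_mod_cast Real.goldenRatio_sq⟩
  have hs' : ((s : ℤ) : ℂ) * ((s : ℤ) : ℂ) = 1 := by
    rcases Int.units_eq_one_or s with rfl | rfl <;> simp
  have hy0 : y ≠ 0 := by rintro rfl; simp at hy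
  have h5 := congrArg (Polynomial.evalRingHom (((s : ℤ) : ℂ) * y)) h4
  simp only [map_mul, map_pow, map_intCast, map_torsionValue, map_reverseTorsionValue] at h5
  simp only [Polynomial.coe_evalRingHom, Polynomial.eval_X, ← mul_assoc, hs', one_mul,
    torsionValue_eq_zero hy, mul_zero] at h5
  exact mul_ne_zero (pow_ne_zero _ (mul_ne_zero (left_ne_zero_of_mul_eq_one hs') hy0))
    (reverseTorsionValue_ne_zero hy) h5

/-- The Wada invariant of the representation that maps each generator to `± C`. With `x = ± t`,
the determinant of `M⁰` is, up to units, `f(x C) f((x C)⁻¹)`, and the factor `(x - 1)(x² + x - 1)`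
cancels with the denominator. -/
theorem wada_dotEq {k : ℕ} (D : KnotDiagram k) {c₀ a₀ : Fin (k + 1)}
    (hΔ : LaurentDotEq (D.alexanderPolynomial c₀ a₀)
        ((T 2 - T 1 - 1) * (T (-2) - T (-1) - 1))) {s : ℤˣ} {γ : D.knotGroup →* GL (Fin 3) ℂ}
    (hγ : ∀ a, γ (D.gen a) = complexCompanion s) :
    DotEq (D.wada c₀ a₀ γ) (torsionValue (((s : ℤ) : RatFunc ℂ) * RatFunc.X)) := by
  obtain ⟨e, i, hΔ⟩ := hΔ
  obtain ⟨e', he'⟩ := det_laurentAeval_unit s e i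
  have h1 : (D.Phi γ (MonoidAlgebra.of ℤ _ (D.gen a₀) - 1)).det
      = -((((s : ℤ) : ℂ[T;T⁻¹]) * T 1 - 1) *
        ((((s : ℤ) : ℂ[T;T⁻¹]) * T 1) ^ 2 + ((s : ℤ) : ℂ[T;T⁻¹]) * T 1 - 1)) := by
    rw [D.Phi_eq_laurentAeval hγ, map_sub, map_sub, map_one, map_one, D.abelRingHom_of,
      D.abelianize_gen, toAdd_ofAdd, laurentAeval_companion_T_one, det_companion_sub_one]
  have h2 : (T 2 : ℤ[T;T⁻¹]) = T 1 * T 1 := by rw [← T_add]; rfl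
  have h3 : (T (-2) : ℤ[T;T⁻¹]) = T (-1) * T (-1) := by rw [← T_add]; rfl
  have hX : (RatFunc.X : RatFunc ℂ) ≠ 0 := RatFunc.X_ne_zero
  rw [KnotDiagram.wada, h1, D.det_foxMatrix₀ hγ, ← D.alexanderPolynomial_eq_det, hΔ, map_mul,
    det_mul, he', h2, h3]
  simp only [map_sub, map_mul, map_one, det_mul]
  rw [laurentAeval_companion_T_one, laurentAeval_companion_T_neg_one, det_fib_companion,
    det_fib_companion_inv]
  simp only [map_mul, map_sub, map_add, map_pow, map_one, map_neg, map_intCast, map_ofNat,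
    laurentToRatFunc_T, zpow_one, _root_.zpow_neg_one]
  have hs : (((s : ℤ) : RatFunc ℂ)) * ((s : ℤ) : RatFunc ℂ) = 1 := by
    rcases Int.units_eq_one_or s with rfl | rfl <;> simp
  have hne := torsionValue_X_ne_zero (-s)
  set x : RatFunc ℂ := ((s : ℤ) : RatFunc ℂ) * RatFunc.X with hx
  have hx0 : x ≠ 0 := mul_ne_zero (left_ne_zero_of_mul_eq_one hs) hX
  have hxi : ((s : ℤ) : RatFunc ℂ) * RatFunc.X⁻¹ = x⁻¹ := by
    rw [hx, mul_inv, ← eq_inv_of_mul_eq_one_left hs]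
  have hx2 : x ^ 2 = RatFunc.X ^ 2 := by
    rw [hx, mul_pow, pow_two, hs, one_mul]
  -- Both factors of the denominator divide the value at `-x`.
  have hfac : torsionValue ((((-s : ℤˣ) : ℤ) : RatFunc ℂ) * RatFunc.X)
      = -((x - 1) * (x ^ 2 + x - 1)) * ((x + 1) * (x - 1) * (x ^ 2 + 3 * x + 1) *
        (x ^ 2 - 3 * x + 1)) := by
    rw [hx, torsionValue]
    push_cast
    ring
  rw [hfac] at hne
  have hden := left_ne_zero_of_mul hne
  refine ⟨e', 3 * i - 6, ?_⟩
  have h6 : (RatFunc.X : RatFunc ℂ) ^ (3 * i - 6) = RatFunc.X ^ (3 * i) * (x⁻¹) ^ 6 := by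
    rw [zpow_sub₀ hX, div_eq_mul_inv, inv_pow]
    congr 2
    calc (RatFunc.X : RatFunc ℂ) ^ (6 : ℤ) = (RatFunc.X ^ 2) ^ 3 := by rw [← pow_mul]; rfl
      _ = x ^ 6 := by rw [← hx2, ← pow_mul]
  rw [hxi, h6, div_eq_iff hden, torsionValue]
  field_simp
  ring

/-- A conjugation of `γ` to its dual would equate the traces `± 2` of `± C` and `0` of its
inverse. -/
theorem not_conjugateToDual {G : Type} [Group G] {γ : G →* GL (Fin 3) ℂ} {s : ℤˣ} {g : G}
    (hg : γ g = complexCompanion s) : ¬ ConjugateToDual γ := by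
  rintro ⟨A, hA⟩
  have h := congrArg Matrix.trace (hA g)
  rw [hg, Matrix.trace_transpose, trace_complexCompanion_inv, Units.val_mul, Matrix.trace_mul_comm,
    ← Units.val_mul, ← mul_assoc, mul_inv_cancel, one_mul, trace_complexCompanion] at h
  rcases Int.units_eq_one_or s with rfl | rfl <;> simp at h

theorem DotEq.units_mul {p q : RatFunc ℂ} (h : DotEq p q) (s : ℤˣ) :
    DotEq (((s : ℤ) : RatFunc ℂ) * p) q := by
  obtain ⟨e, i, rfl⟩ := h
  exact ⟨s * e, i, by push_cast; ring⟩

theorem DotEq.ne_zero {p q : RatFunc ℂ} (h : DotEq p q) (hq : q ≠ 0) : p ≠ 0 := by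
  obtain ⟨e, i, rfl⟩ := h
  refine mul_ne_zero (mul_ne_zero ?_ (zpow_ne_zero _ RatFunc.X_ne_zero)) hq
  rcases Int.units_eq_one_or e with rfl | rfl <;> simp

/-- The part of the theorem that concerns one complex representation, for both signs at once. -/
theorem torsion_of_gen_eq_companion {k : ℕ} (D : KnotDiagram k) {c₀ a₀ : Fin (k + 1)}
    (hΔ : LaurentDotEq (D.alexanderPolynomial c₀ a₀)
        ((T 2 - T 1 - 1) * (T (-2) - T (-1) - 1))) {s : ℤˣ} {γ : D.knotGroup →* GL (Fin 3) ℂ}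
    (hγ : ∀ a, γ (D.gen a) = complexCompanion s) :
    ¬ ConjugateToDual γ ∧ D.IsTwistedTorsion c₀ γ (D.wada c₀ a₀ γ) ∧
      ∀ τ : RatFunc ℂ, D.IsTwistedTorsion c₀ γ τ →
        DotEq τ (torsionValue (((s : ℤ) : RatFunc ℂ) * RatFunc.X)) ∧ ¬ Reciprocal τ := by
  have hW := wada_dotEq D hΔ hγ
  have hW0 := hW.ne_zero (torsionValue_X_ne_zero s)
  refine ⟨not_conjugateToDual (hγ a₀), D.isTwistedTorsion_wada hW0, fun τ hτ => ?_⟩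
  obtain ⟨e, rfl⟩ := hτ.eq_wada D hW0
  exact ⟨hW.units_mul e, not_reciprocal (hW.units_mul e)⟩

/-- The matrix `-C`, as an element of `SL₃(ℤ)`. -/
def negCompanionSL : Matrix.SpecialLinearGroup (Fin 3) ℤ :=
  ⟨-companionMatrix, by simp [companionMatrix, det_fin_three]⟩

/-! ### Determinants of matrices of polynomials with integer coefficients -/

section PolyMatrix

variable {m : Type} [Fintype m] {R : Type} [CommRing R]

/-- The value at `t` of the matrix polynomial of degree less than `N` with the coefficients `V`. -/
def evalMatrixPoly (N : ℕ) (V : ℕ → Matrix m m ℤ) (t : R) : Matrix m m R :=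
  Matrix.of fun i j => ∑ n ∈ Finset.range N, t ^ n * (V n i j : R)

/-- The coefficients of the product of `A + t B` and the matrix polynomial with coefficients `V`. -/
def linearMulCoeff (A B : Matrix m m ℤ) (V : ℕ → Matrix m m ℤ) : ℕ → Matrix m m ℤ
  | 0 => A * V 0
  | n + 1 => A * V (n + 1) + B * V n

theorem linear_mul_evalMatrixPoly (A B : Matrix m m ℤ) {V : ℕ → Matrix m m ℤ} {N : ℕ}
    (hV : V N = 0) (t : R) :
    Matrix.of (fun i j => (A i j : R) + (B i j : R) * t) * evalMatrixPoly N V t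
      = evalMatrixPoly (N + 1) (linearMulCoeff A B V) t := by
  ext i j
  have hA : ∑ n ∈ Finset.range (N + 1), t ^ n * ((A * V n) i j : R)
      = ∑ x, (A i x : R) * ∑ n ∈ Finset.range N, t ^ n * (V n x j : R) := by
    rw [Finset.sum_range_succ, hV]
    simp only [Matrix.mul_apply, Int.cast_sum, Int.cast_mul, Finset.mul_sum, Matrix.zero_apply,
      mul_zero, Int.cast_zero, Finset.sum_const_zero, add_zero]
    rw [Finset.sum_comm]
    exact Finset.sum_congr rfl fun _ _ => Finset.sum_congr rfl fun _ _ => by ring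
  have hB : ∑ n ∈ Finset.range N, t ^ (n + 1) * ((B * V n) i j : R)
      = ∑ x, (B i x : R) * t * ∑ n ∈ Finset.range N, t ^ n * (V n x j : R) := by
    simp only [Matrix.mul_apply, Int.cast_sum, Int.cast_mul, Finset.mul_sum]
    rw [Finset.sum_comm]
    exact Finset.sum_congr rfl fun _ _ => Finset.sum_congr rfl fun _ _ => by ring
  simp only [Matrix.mul_apply, evalMatrixPoly, of_apply, add_mul, Finset.sum_add_distrib]
  rw [← hA, ← hB, Finset.sum_range_succ', Finset.sum_range_succ']
  simp only [linearMulCoeff, Matrix.add_apply, Int.cast_add, mul_add, Finset.sum_add_distrib]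
  ring

end PolyMatrix

namespace KnotDiagram

variable {k : ℕ} (D : KnotDiagram k)

/-- The constant coefficients of the entries of the Alexander matrix. -/
def alexanderConst : Matrix (Fin (k + 1)) (Fin (k + 1)) ℤ := Matrix.of fun c j =>
  (if D.arc (D.upper c) = j then 1 else 0) -
    (if (if D.positive c = true then D.arc (D.lower c) else c) = j then 1 else 0)

/-- The coefficients at `t` of the entries of the Alexander matrix. -/
def alexanderLin : Matrix (Fin (k + 1)) (Fin (k + 1)) ℤ := Matrix.of fun c j =>
  (if (if D.positive c = true then c else D.arc (D.lower c)) = j then 1 else 0) -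
    (if D.arc (D.upper c) = j then 1 else 0)

/-- The entries of the Alexander matrix are linear polynomials in `t`: the abelianized relator at a
crossing reads `(1 - t) o + t j - i` or `(1 - t) o + t i - j`. -/
theorem alexanderMatrix_apply (c j : Fin (k + 1)) :
    D.alexanderMatrix c j =
      (D.alexanderConst c j : ℤ[T;T⁻¹]) + (D.alexanderLin c j : ℤ[T;T⁻¹]) * T 1 := by
  have hof : ∀ g, D.abelRingHom
      (MonoidAlgebra.mapDomainRingHom ℤ (PresentedGroup.mk (Set.range D.relator))
      (MonoidAlgebra.of ℤ _ g))
        = T (D.abelianize (PresentedGroup.mk (Set.range D.relator) g)).toAdd := fun g => by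
    rw [← abelRingHom_of]
    simp
  have hgen : ∀ a, D.abelianize (PresentedGroup.mk (Set.range D.relator) (FreeGroup.of a))
      = Multiplicative.ofAdd 1 := D.abelianize_gen
  have h1 : ∀ a, D.abelRingHom
      (MonoidAlgebra.mapDomainRingHom ℤ (PresentedGroup.mk (Set.range D.relator))
      (MonoidAlgebra.of ℤ _ (FreeGroup.of a))) = T 1 := fun a => by
    rw [hof, hgen, toAdd_ofAdd]
  have h2 : ∀ a, D.abelRingHom
      (MonoidAlgebra.mapDomainRingHom ℤ (PresentedGroup.mk (Set.range D.relator))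
      (MonoidAlgebra.of ℤ _ (FreeGroup.of a)⁻¹)) = T (-1) := fun a => by
    rw [hof, map_inv, map_inv, hgen, toAdd_inv, toAdd_ofAdd]
  have hT : (T 1 : ℤ[T;T⁻¹]) * T (-1) = 1 := by rw [← T_add]; simp
  have hδ : ∀ p : Prop, [Decidable p] → D.abelRingHom
      (MonoidAlgebra.mapDomainRingHom ℤ (PresentedGroup.mk (Set.range D.relator))
      (if p then 1 else 0)) = if p then 1 else 0 := fun p _ => by
    split_ifs <;> simp
  simp only [alexanderMatrix, of_apply, relator, alexanderConst, alexanderLin]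
  generalize (T 1 : ℤ[T;T⁻¹]) = t at *
  generalize (T (-1) : ℤ[T;T⁻¹]) = u at *
  by_cases hp : D.positive c = true
  all_goals
    simp only [hp, if_true, Bool.false_eq_true, if_false, foxDeriv_mul, foxDeriv_inv, foxDeriv_of, map_add, map_mul, map_neg, h1, h2, hδ,
      Int.cast_sub, Int.cast_ite, Int.cast_one, Int.cast_zero]
  · linear_combination (-(t * if D.arc (D.upper c) = j then 1 else 0) -
      (1 + t * u) * if D.arc (D.lower c) = j then 1 else 0) * hT
  · linear_combination (-(t * if D.arc (D.upper c) = j then 1 else 0) -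
      (1 + t * u) * if c = j then 1 else 0) * hT

end KnotDiagram

/-! ### A knot with Alexander polynomial `t⁴ - 3 t² + 1` -/

/-- A diagram with 12 crossings of the closure of the braid
`σ₃⁻² σ₂ σ₁⁻¹ σ₃² σ₄ σ₃⁻¹ σ₄ σ₂ σ₁⁻¹ σ₃⁻¹`, where `σᵢ` stands for a negative crossing. -/
def exampleGauss : GaussDiagram 11 where
  upper := ![13, 7, 23, 9, 3, 11, 16, 6, 21, 15, 19, 1]
  lower := ![0, 20, 14, 2, 10, 4, 5, 17, 18, 12, 8, 22]
  bijective := by decide +kernel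
  positive := ![true, false, true, true, true, true, false, false, true, false, false, false]
  arc := ![11, 0, 0, 3, 3, 5, 6, 6, 6, 10, 10, 4, 4, 9, 9, 2, 2, 2, 7, 8, 8, 1, 1, 11]
  arc_lower := by decide +kernel
  arc_upper := by decide +kernel

/-- The number of the face to the left of a dart. -/
def exampleFace (d : GaussDiagram.Dart 11) : Fin 14 :=
  if d.2 then ![1, 0, 9, 4, 11, 4, 13, 4, 5, 4, 10, 4, 12, 0, 3, 8, 12, 4, 7, 6, 5, 6, 9, 8] d.1
  else ![2, 3, 8, 10, 8, 12, 0, 7, 6, 9, 8, 11, 8, 1, 2, 1, 0, 13, 0, 9, 4, 7, 0, 3] d.1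

/-- The dart that follows a dart on the boundary of the face to its left. -/
def exampleNext (d : GaussDiagram.Dart 11) : GaussDiagram.Dart 11 :=
  if d.2 then
    ![(13, false), (22, false), (9, false), (11, true), (11, false), (17, true), (17, false),
      (20, false), (20, true), (3, true), (3, false), (5, true), (16, true), (1, true),
      (23, false), (12, false), (5, false), (7, true), (21, false), (8, false), (8, true),
      (19, true), (2, true), (15, true)] d.1
  else
    ![(14, false), (14, true), (23, true), (10, true), (10, false), (12, true), (16, false),
      (18, true), (21, true), (19, false), (2, false), (4, true), (4, false), (15, false),
      (0, false), (0, true), (13, true), (6, true), (6, false), (22, true), (9, true), (7, false),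
      (18, false), (1, false)] d.1

/-- A dart on the boundary of each face. -/
def exampleFaceDart : Fin 14 → GaussDiagram.Dart 11 :=
  ![(1, true), (0, true), (0, false), (14, true), (3, true), (8, true), (19, true), (18, true),
    (15, true), (2, true), (10, true), (4, true), (12, true), (6, true)]

theorem exampleFace_eq {d d' : GaussDiagram.Dart 11} (h : exampleGauss.TurnLeft d d') :
    exampleFace d = exampleFace d' := by
  have h1 : ∀ c, exampleGauss.positive c = true →
      exampleFace (exampleGauss.upper c, true) = exampleFace (exampleGauss.lower c + 1, true) ∧
      exampleFace (exampleGauss.lower c, true) = exampleFace (exampleGauss.upper c, false) ∧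
      exampleFace (exampleGauss.upper c + 1, false) = exampleFace (exampleGauss.lower c, false) ∧
      exampleFace (exampleGauss.lower c + 1, false)
        = exampleFace (exampleGauss.upper c + 1, true) := by decide +kernel
  have h2 : ∀ c, exampleGauss.positive c = false →
      exampleFace (exampleGauss.upper c, true) = exampleFace (exampleGauss.lower c, false) ∧
      exampleFace (exampleGauss.lower c, true) = exampleFace (exampleGauss.upper c + 1, true) ∧
      exampleFace (exampleGauss.upper c + 1, false)
        = exampleFace (exampleGauss.lower c + 1, true) ∧
      exampleFace (exampleGauss.lower c + 1, false)
        = exampleFace (exampleGauss.upper c, false) := by decide +kernel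
  cases h with
  | pos_upper c h => exact (h1 c h).1
  | pos_lower c h => exact (h1 c h).2.1
  | pos_upper_back c h => exact (h1 c h).2.2.1
  | pos_lower_back c h => exact (h1 c h).2.2.2
  | neg_upper c h => exact (h2 c h).1
  | neg_lower c h => exact (h2 c h).2.1
  | neg_upper_back c h => exact (h2 c h).2.2.1
  | neg_lower_back c h => exact (h2 c h).2.2.2

theorem exampleNext_turnLeft (d : GaussDiagram.Dart 11) :
    exampleGauss.TurnLeft d (exampleNext d) := by
  have h : ∀ d : GaussDiagram.Dart 11, ∃ c,
      (exampleGauss.positive c = true ∧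
        (d = (exampleGauss.upper c, true) ∧ exampleNext d = (exampleGauss.lower c + 1, true) ∨
        d = (exampleGauss.lower c, true) ∧ exampleNext d = (exampleGauss.upper c, false) ∨
        d = (exampleGauss.upper c + 1, false) ∧ exampleNext d = (exampleGauss.lower c, false) ∨
        d = (exampleGauss.lower c + 1, false) ∧
          exampleNext d = (exampleGauss.upper c + 1, true))) ∨
      (exampleGauss.positive c = false ∧
        (d = (exampleGauss.upper c, true) ∧ exampleNext d = (exampleGauss.lower c, false) ∨
        d = (exampleGauss.lower c, true) ∧ exampleNext d = (exampleGauss.upper c + 1, true) ∨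
        d = (exampleGauss.upper c + 1, false) ∧ exampleNext d = (exampleGauss.lower c + 1, true) ∨
        d = (exampleGauss.lower c + 1, false) ∧
          exampleNext d = (exampleGauss.upper c, false))) := by decide +kernel
  obtain ⟨c, ⟨hc, h | h | h | h⟩ | ⟨hc, h | h | h | h⟩⟩ := h d <;> rw [h.2, h.1]
  · exact .pos_upper c hc
  · exact .pos_lower c hc
  · exact .pos_upper_back c hc
  · exact .pos_lower_back c hc
  · exact .neg_upper c hc
  · exact .neg_lower c hc
  · exact .neg_upper_back c hc
  · exact .neg_lower_back c hc

theorem mk_exampleNext_iterate (n : ℕ) (d : GaussDiagram.Dart 11) :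
    (Quot.mk _ (exampleNext^[n] d) : exampleGauss.Face) = Quot.mk _ d := by
  induction n generalizing d with
  | zero => rfl
  | succ n ih =>
    rw [Function.iterate_succ_apply, ih]
    exact (Quot.sound (exampleNext_turnLeft d)).symm

theorem card_exampleGauss_face : Nat.card exampleGauss.Face = 14 := by
  -- Every dart is joined to the chosen dart of its face by at most seven left turns.
  have h : ∀ d, ∃ n : Fin 8, exampleNext^[n] d = exampleFaceDart (exampleFace d) := by
    decide +kernel
  have hr : ∀ f, exampleFace (exampleFaceDart f) = f := by decide +kernel
  let e : exampleGauss.Face ≃ Fin 14 :=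
    { toFun := Quot.lift exampleFace fun _ _ => exampleFace_eq
      invFun := fun f => Quot.mk _ (exampleFaceDart f)
      left_inv := by
        rintro ⟨d⟩
        obtain ⟨n, hn⟩ := h d
        change (Quot.mk _ (exampleFaceDart (exampleFace d)) : exampleGauss.Face) = Quot.mk _ d
        rw [← hn, mk_exampleNext_iterate]
      right_inv := hr }
  rw [Nat.card_congr e, Nat.card_fin]

/-- The diagram `exampleGauss` as a diagram of a classical knot. -/
def exampleKnot : KnotDiagram 11 where
  toGaussDiagram := exampleGauss
  planar := card_exampleGauss_face

/-- An order of the remaining Wirtinger relators in which the relator numbered `i < 9` involves, of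
the first nine arcs, only those up to `i`, and the arc `i` with a coefficient `t` or `-1`. -/
def exampleRows : Equiv.Perm (Fin 11) where
  toFun := ![0, 10, 2, 3, 4, 5, 6, 7, 1, 8, 9]
  invFun := ![0, 8, 2, 3, 4, 5, 6, 7, 9, 10, 1]
  left_inv := by decide +kernel
  right_inv := by decide +kernel

/-- The coefficients of an upper triangular matrix `V` such that `M⁰ V` is lower triangular.
It differs from the identity in the columns `9` and `10`, which solve the first nine and the first
ten relators, respectively. -/
def exampleColumns (n : ℕ) : Matrix (Fin 11) (Fin 11) ℤ := Matrix.of fun i j =>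
  if j = 9 then
    ((![[0, 0, 0, -1, 1], [0, 0, 1, -2, 1], [0, 0, 0, 1], [0, 0, -1, 1], [0, 1, -2, 1],
      [-1, 2, -2, 1], [0, -1, 2, -1], [0, -1, 3, -3, 2], [1, -2, 1], [0, 0, 0, 0, 1], []] :
      Fin 11 → List ℤ) i).getD n 0
  else if j = 10 then
    ((![[0, 0, 1, -2, 2, -1], [0, -1, 3, -4, 3, -1], [0, 0, -1, 1, -1], [0, 0, 0, 2, -2],
      [0, 1, -3, 3, -2], [-1, 4, -4, 3, -2], [0, -1, 3, -2, 1, -1], [0, -1, 4, -6, 4, -3, 1],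
      [0, -1, 1, 0, 1, -1], [0, 0, 0, -1, 1, -1], [0, 0, 1, -1, -1]] :
      Fin 11 → List ℤ) i).getD n 0
  else if n = 0 ∧ i = j then 1 else 0

/-- The constant coefficients of the Alexander matrix `M⁰` with the reordered rows. -/
def exampleConst : Matrix (Fin 11) (Fin 11) ℤ :=
  exampleKnot.alexanderConst.submatrix (fun i => (8 : Fin 12).succAbove (exampleRows i))
    (11 : Fin 12).succAbove

/-- The coefficients at `t` of the Alexander matrix `M⁰` with the reordered rows. -/
def exampleLin : Matrix (Fin 11) (Fin 11) ℤ :=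
  exampleKnot.alexanderLin.submatrix (fun i => (8 : Fin 12).succAbove (exampleRows i))
    (11 : Fin 12).succAbove

theorem det_exampleColumns {R : Type} [CommRing R] (t : R) :
    (evalMatrixPoly 7 exampleColumns t).det = t ^ 4 * (t ^ 2 - t ^ 3 - t ^ 4) := by
  have h0 : ∀ n : Fin 7, ∀ p : Fin 11 × Fin 11, p.2 < p.1 →
      exampleColumns n p.1 p.2 = 0 := by decide +kernel
  have h1 : ∀ n : Fin 7, ∀ i : Fin 11, exampleColumns n i i =
      ((![[1], [1], [1], [1], [1], [1], [1], [1], [1], [0, 0, 0, 0, 1], [0, 0, 1, -1, -1]] :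
        Fin 11 → List ℤ) i).getD n 0 := by decide +kernel
  rw [det_of_isUpperTriangular]
  · have h2 : ∀ i, evalMatrixPoly 7 exampleColumns t i i = ∑ n : Fin 7, t ^ n.1 *
      (((![[1], [1], [1], [1], [1], [1], [1], [1], [1], [0, 0, 0, 0, 1], [0, 0, 1, -1, -1]] :
        Fin 11 → List ℤ) i).getD n 0 : R) := fun i => by
      simp only [evalMatrixPoly, of_apply, Finset.sum_range, h1]
    simp only [h2]
    simp [Fin.prod_univ_succ, Fin.sum_univ_succ]
    ring
  · intro i j hij
    rw [evalMatrixPoly, of_apply, Finset.sum_range]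
    exact Finset.sum_eq_zero fun n _ => by rw [h0 n (i, j) hij, Int.cast_zero, mul_zero]

theorem det_exampleProduct {R : Type} [CommRing R] (t : R) :
    (evalMatrixPoly 8 (linearMulCoeff exampleConst exampleLin exampleColumns) t).det
      = t ^ 7 * (t ^ 2 - t ^ 3 - t ^ 4) * (-t + 3 * t ^ 3 - t ^ 5) := by
  have h0 : ∀ n : Fin 8, ∀ p : Fin 11 × Fin 11, p.1 < p.2 →
      linearMulCoeff exampleConst exampleLin exampleColumns n p.1 p.2 = 0 := by decide +kernel
  have h1 : ∀ n : Fin 8, ∀ i : Fin 11,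
      linearMulCoeff exampleConst exampleLin exampleColumns n i i =
      ((![[0, 1], [0, 1], [0, 1], [0, 1], [0, 1], [0, 1], [-1], [-1], [0, 1], [0, 0, 1, -1, -1],
        [0, -1, 0, 3, 0, -1]] : Fin 11 → List ℤ) i).getD n 0 := by decide +kernel
  rw [det_of_isLowerTriangular]
  · have h2 : ∀ i, evalMatrixPoly 8 (linearMulCoeff exampleConst exampleLin exampleColumns) t i i
        = ∑ n : Fin 8, t ^ n.1 *
      (((![[0, 1], [0, 1], [0, 1], [0, 1], [0, 1], [0, 1], [-1], [-1], [0, 1], [0, 0, 1, -1, -1],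
        [0, -1, 0, 3, 0, -1]] : Fin 11 → List ℤ) i).getD n 0 : R) := fun i => by
      simp only [evalMatrixPoly, of_apply, Finset.sum_range, h1]
    simp only [h2]
    simp [Fin.prod_univ_succ, Fin.sum_univ_succ]
    ring
  · intro i j hij
    rw [evalMatrixPoly, of_apply, Finset.sum_range]
    exact Finset.sum_eq_zero fun n _ => by rw [h0 n (i, j) hij, Int.cast_zero, mul_zero]

theorem exampleKnot_alexanderPolynomial :
    LaurentDotEq (exampleKnot.alexanderPolynomial 8 11)
      ((T 2 - T 1 - 1) * (T (-2) - T (-1) - 1)) := by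
  have hM : (exampleKnot.alexanderMatrix₀ 8 11).submatrix exampleRows id
      = Matrix.of fun i j => (exampleConst i j : ℤ[T;T⁻¹]) + (exampleLin i j : ℤ[T;T⁻¹]) * T 1 := by
    ext1 i j
    exact exampleKnot.alexanderMatrix_apply _ _
  have hV : exampleColumns 7 = 0 := by decide +kernel
  have h := congrArg Matrix.det (linear_mul_evalMatrixPoly exampleConst exampleLin hV
    (T 1 : ℤ[T;T⁻¹]))
  -- `det M⁰` is, up to sign, the quotient of the determinants of two triangular matrices.
  rw [← hM, det_mul, det_permute, det_exampleColumns, det_exampleProduct,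
    ← exampleKnot.alexanderPolynomial_eq_det] at h
  have hne : (T 1 : ℤ[T;T⁻¹]) ^ 4 * (T 1 ^ 2 - T 1 ^ 3 - T 1 ^ 4) ≠ 0 := fun h0 => by
    have := congrArg (eval₂ (RingHom.id ℤ) 1) h0
    simp at this
  have hT : (T 1 : ℤ[T;T⁻¹]) * T (-1) = 1 := by rw [← T_add]; simp
  have h2 : (T 2 : ℤ[T;T⁻¹]) = T 1 * T 1 := by rw [← T_add]; rfl
  have h3 : (T (-2) : ℤ[T;T⁻¹]) = T (-1) * T (-1) := by rw [← T_add]; rfl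
  have h6 : (T 6 : ℤ[T;T⁻¹]) = T 1 ^ 6 := by simp [T_pow]
  have hq : (T 1 : ℤ[T;T⁻¹]) ^ 2 * (T (-1) * T (-1) - T (-1) - 1) = 1 - T 1 - T 1 ^ 2 := by
    linear_combination (T 1 * T (-1) + 1 - T 1) * hT
  have key : ((Equiv.Perm.sign exampleRows : ℤ) : ℤ[T;T⁻¹]) *
      exampleKnot.alexanderPolynomial 8 11 = T 6 * ((T 2 - T 1 - 1) * (T (-2) - T (-1) - 1)) := by
    apply mul_right_cancel₀ hne
    rw [h, h6, h2, h3]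
    linear_combination -(T 1 ^ 8 * (T 1 ^ 2 - T 1 ^ 3 - T 1 ^ 4) * (T 1 ^ 2 - T 1 - 1)) * hq
  have hsign : ((Equiv.Perm.sign exampleRows : ℤ) : ℤ[T;T⁻¹]) *
      ((Equiv.Perm.sign exampleRows : ℤ) : ℤ[T;T⁻¹]) = 1 := by
    rcases Int.units_eq_one_or (Equiv.Perm.sign exampleRows) with h | h <;> rw [h] <;> simp
  refine ⟨Equiv.Perm.sign exampleRows, 6, ?_⟩
  have hC : (C ((Equiv.Perm.sign exampleRows : ℤˣ) : ℤ) : ℤ[T;T⁻¹])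
      = ((Equiv.Perm.sign exampleRows : ℤ) : ℤ[T;T⁻¹]) := by simp
  rw [hC, mul_assoc, ← key, ← mul_assoc, hsign, one_mul]

/-! ### Failure of reciprocality -/

theorem mainTheorem3 :
    (∃ (k : ℕ) (D : KnotDiagram k) (c₀ a₀ : Fin (k + 1)),
      LaurentDotEq (D.alexanderPolynomial c₀ a₀)
        ((T 2 - T 1 - 1) * (T (-2) - T (-1) - 1))) ∧
    ∀ (k : ℕ) (D : KnotDiagram k) (c₀ a₀ : Fin (k + 1)),
      LaurentDotEq (D.alexanderPolynomial c₀ a₀)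
        ((T 2 - T 1 - 1) * (T (-2) - T (-1) - 1)) →
      ((∃! γ : D.knotGroup →* GL (Fin 3) ℤ, ∀ a, (γ (D.gen a)).1 = companionMatrix) ∧
        ∀ γ : D.knotGroup →* GL (Fin 3) ℤ, (∀ a, (γ (D.gen a)).1 = companionMatrix) →
          ¬ ConjugateToDual (complexify γ) ∧
          D.IsTwistedTorsion c₀ (complexify γ) (D.wada c₀ a₀ (complexify γ)) ∧
          ∀ τ : RatFunc ℂ, D.IsTwistedTorsion c₀ (complexify γ) τ →
            DotEq τ
              ((RatFunc.X ^ 2 - RatFunc.X - 1) * (RatFunc.X - 1) * (RatFunc.X + 1) ^ 2 *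
                (RatFunc.X ^ 2 - 3 * RatFunc.X + 1) * (RatFunc.X ^ 2 + 3 * RatFunc.X + 1)) ∧
            ¬ Reciprocal τ) ∧
      ((∃! γ : D.knotGroup →* Matrix.SpecialLinearGroup (Fin 3) ℤ,
          ∀ a, (γ (D.gen a)).1 = -companionMatrix) ∧
        ∀ γ : D.knotGroup →* Matrix.SpecialLinearGroup (Fin 3) ℤ,
          (∀ a, (γ (D.gen a)).1 = -companionMatrix) →
          ¬ ConjugateToDual (complexify (Matrix.SpecialLinearGroup.toGL.comp γ)) ∧
          D.IsTwistedTorsion c₀ (complexify (Matrix.SpecialLinearGroup.toGL.comp γ))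
            (D.wada c₀ a₀ (complexify (Matrix.SpecialLinearGroup.toGL.comp γ))) ∧
          ∀ τ : RatFunc ℂ,
            D.IsTwistedTorsion c₀ (complexify (Matrix.SpecialLinearGroup.toGL.comp γ)) τ →
            DotEq τ
              ((RatFunc.X ^ 2 + RatFunc.X - 1) * (RatFunc.X + 1) * (RatFunc.X - 1) ^ 2 *
                (RatFunc.X ^ 2 - 3 * RatFunc.X + 1) * (RatFunc.X ^ 2 + 3 * RatFunc.X + 1)) ∧
            ¬ Reciprocal τ) := by
  refine ⟨⟨11, exampleKnot, 8, 11, exampleKnot_alexanderPolynomial⟩,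
    fun k D c₀ a₀ hΔ => ⟨⟨?_, fun γ hγ => ?_⟩, ?_, fun γ hγ => ?_⟩⟩
  · have h : (signedCompanion 1).1 = companionMatrix := by simp [signedCompanion]
    simp only [← h, ← Units.ext_iff]
    exact D.existsUnique_hom_const _
  · have h : ∀ a, complexify γ (D.gen a) = complexCompanion 1 := fun a => Units.ext <| by
      rw [complexCompanion_val, Units.val_one, one_smul, ← hγ a]
      rfl
    simpa [torsionValue] using torsion_of_gen_eq_companion D hΔ h
  · have h : ∀ g : Matrix.SpecialLinearGroup (Fin 3) ℤ,
        g.1 = -companionMatrix ↔ g = negCompanionSL :=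
      fun g => ⟨fun h => Subtype.ext h, fun h => h ▸ rfl⟩
    simp only [h]
    exact D.existsUnique_hom_const _
  · have h : ∀ a, complexify (Matrix.SpecialLinearGroup.toGL.comp γ) (D.gen a)
        = complexCompanion (-1) := fun a => Units.ext <| by
      rw [complexCompanion_val, Units.val_neg, Units.val_one, neg_one_smul, ← hγ a]
      rfl
    obtain ⟨h1, h2, h3⟩ := torsion_of_gen_eq_companion D hΔ h
    refine ⟨h1, h2, fun τ hτ => ⟨?_, (h3 τ hτ).2⟩⟩
    obtain ⟨e, i, hei⟩ := (h3 τ hτ).1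
    refine ⟨-e, i, hei.trans ?_⟩
    simp only [torsionValue, Units.val_neg, Units.val_one]
    push_cast
    ring

end
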